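/- **Proposition 6.2.** Let $G=\langle x_1,\dots,x_n\mid r_1,\dots,r_m\rangle$ be a finitely presented group all of whose relators $r_j$ lie in the commutator subgroup $\Gamma_2 F_n=(F_n,F_n)$ of the free group $F_n=\langle x_1,\dots,x_n\rangle$ (so that $H_1(G;\mathbb Z)=G/G'$ is free abelian on the classes of $x_1,\dots,x_n$). Let $\mathfrak H(G)$ be the integral holonomy Lie algebra of $G$, that is, $$\mathfrak H(G)=\mathbf L(H_1(G;\mathbb Z))\,/\,\mathrm{ideal}\big(\mathrm{im}(\partial_G\circ\kappa)\big),$$ where $\mathbf L(H_1(G;\mathbb Z))$ is the free Lie algebra over $\mathbb Z$ on the abelian group $H_1(G;\mathbb Z)$, graded by bracket length; $\kappa\colon H_2(G;\mathbb Z)\to\mathrm{Hom}(H^2(G;\mathbb Z),\mathbb Z)$ is induced by the Kronecker pairing; and $\partial_G\colon \mathrm{Hom}(H^2(G;\mathbb Z),\mathbb Z)\to\bigwedge^2H_1(G;\mathbb Z)=\mathbf L^2(H_1(G;\mathbb Z))$, where $a\wedge b$ corresponds to $[a,b]$, is dual to the cup product $\bigwedge^2H^1(G;\mathbb Z)\to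 H^2(G;\mathbb Z)$. Let $\mathbf L(y_1,\dots,y_n)$ be the free Lie algebra over $\mathbb Z$ on $y_1,\dots,y_n$, graded by bracket length. For each $j$ let $\bar r_j\in\mathbf L^2(y_1,\dots,y_n)$ be the class of $r_j$ modulo $\Gamma_3F_n=(\Gamma_2F_n,F_n)$, under the identification $\Gamma_2F_n/\Gamma_3F_n=\mathbf L^2(y_1,\dots,y_n)$ that sends the class of the commutator $(x_i,x_k)$ to $[y_i,y_k]$. Then there is an isomorphism of graded Lie algebras over $\mathbb Z$ $$\mathfrak H(G)\;\cong\;\mathbf L(y_1,\dots,y_n)\,/\,\mathrm{ideal}(\bar r_1,\dots,\bar r_m)$$ which sends, for each $i$, the class of $x_i$ in $H_1(G;\mathbb Z)$ to the class of $y_i$. -/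

import Mathlib

noncomputable section

namespace Holonomy

/-! ### Linear algebra

Everything here is over an arbitrary commutative ring `R`; only `R = ℤ` is used below. -/

section LinearAlgebra

variable {R A B C D M N P : Type*} [CommRing R] [AddCommGroup A] [Module R A]
  [AddCommGroup B] [Module R B] [AddCommGroup C] [Module R C] [AddCommGroup D] [Module R D]
  [AddCommGroup M] [Module R M] [AddCommGroup N] [Module R N] [AddCommGroup P] [Module R P]

/-- Linear maps `A → Hom(B, R)`. -/
abbrev PairingMap (R A B : Type*) [CommRing R] [AddCommGroup A] [Module R A]
    [AddCommGroup B] [Module R B] : Type _ := A →ₗ[R] Module.Dual R B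

/-- Bilinear maps `M × M → P`. -/
abbrev BilinMap (R M P : Type*) [CommRing R] [AddCommGroup M] [Module R M]
    [AddCommGroup P] [Module R P] : Type _ := M →ₗ[R] M →ₗ[R] P

/-- Linear maps `⋀² M → P`. -/
abbrev WedgeMap (R M P : Type*) [CommRing R] [AddCommGroup M] [Module R M]
    [AddCommGroup P] [Module R P] : Type _ := ⋀[R]^2 M →ₗ[R] P

/-- Linear maps `Hom(P, R) → ⋀² M`. -/
abbrev DualToWedge (R P M : Type*) [CommRing R] [AddCommGroup P] [Module R P]
    [AddCommGroup M] [Module R M] : Type _ := Module.Dual R P →ₗ[R] ⋀[R]^2 M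

/-- Linear maps `A → ⋀² M`. -/
abbrev WedgeValued (R A M : Type*) [CommRing R] [AddCommGroup A] [Module R A]
    [AddCommGroup M] [Module R M] : Type _ := A →ₗ[R] ⋀[R]^2 M

/-- Factoring a linear map `f` through a surjective linear map `p`. -/
def factor (p : A →ₗ[R] B) (hp : Function.Surjective p) (f : A →ₗ[R] C)
    (h : ∀ a, p a = 0 → f a = 0) : B →ₗ[R] C :=
  (LinearMap.ker p).liftQ f (fun a ha => h a ha) ∘ₗ
    (p.quotKerEquivOfSurjective hp).symm.toLinearMap

theorem factor_apply (p : A →ₗ[R] B) (hp : Function.Surjective p) (f : A →ₗ[R] C)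
    (h : ∀ a, p a = 0 → f a = 0) (a : A) : factor p hp f h (p a) = f a := by
  have : (p.quotKerEquivOfSurjective hp).symm (p a) = (LinearMap.ker p).mkQ a := by
    rw [LinearEquiv.symm_apply_eq]; rfl
  simp only [factor, LinearMap.comp_apply, LinearEquiv.coe_coe, this]
  exact (LinearMap.ker p).liftQ_apply f a

/-- The pairing of `B` with `D` induced by a pairing `f` of `A` with `C`, for surjections
`p : A → B` and `q : C → D`. -/
def factorPairing (p : A →ₗ[R] B) (hp : Function.Surjective p) (q : C →ₗ[R] D)
    (hq : Function.Surjective q) (f : A →ₗ[R] C →ₗ[R] R)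
    (h : ∀ a, p a = 0 → ∀ c, f a c = 0) (h' : ∀ a c, q c = 0 → f a c = 0) : PairingMap R B D :=
  factor p hp
    { toFun := fun a => factor q hq (f a) (h' a)
      map_add' := fun a a' => by
        ext x
        obtain ⟨c, rfl⟩ := hq x
        simp only [LinearMap.add_apply, factor_apply, map_add]
      map_smul' := fun r a => by
        ext x
        obtain ⟨c, rfl⟩ := hq x
        simp only [LinearMap.smul_apply, factor_apply, map_smul, RingHom.id_apply] }
    (fun a ha => by
      ext x
      obtain ⟨c, rfl⟩ := hq x
      simp only [LinearMap.coe_mk, AddHom.coe_mk, factor_apply, h a ha, LinearMap.zero_apply])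

theorem factorPairing_apply (p : A →ₗ[R] B) (hp : Function.Surjective p) (q : C →ₗ[R] D)
    (hq : Function.Surjective q) (f : A →ₗ[R] C →ₗ[R] R)
    (h : ∀ a, p a = 0 → ∀ c, f a c = 0) (h' : ∀ a c, q c = 0 → f a c = 0) (a : A) (c : C) :
    factorPairing p hp q hq f h h' (p a) (q c) = f a c := by
  simp only [factorPairing, factor_apply, LinearMap.coe_mk, AddHom.coe_mk]

/-- The map `⋀² M → P`, `x ∧ y ↦ B x y`, of a bilinear map `B` that vanishes on the diagonal. -/
def wedgeLift (B : BilinMap R M P) (h : ∀ x, B x x = 0) : WedgeMap R M P :=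
  exteriorPower.alternatingMapLinearEquiv
    { toFun := fun v => B (v 0) (v 1)
      map_update_add' := fun v i x y => by
        fin_cases i <;> simp [Function.update]
      map_update_smul' := fun v i c x => by
        fin_cases i <;> simp [Function.update]
      map_eq_zero_of_eq' := fun v i j hv hij => by
        fin_cases i <;> fin_cases j <;> simp_all }

theorem wedgeLift_apply (B : BilinMap R M P) (h : ∀ x, B x x = 0) (x y : M) :
    wedgeLift B h (exteriorPower.ιMulti R 2 ![x, y]) = B x y := by
  simp [wedgeLift]

/-- For modules `M` and `N` with `N ≃ Hom(M, R)`, the pairing of `⋀² M` with `⋀² N` determined by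
`⟨a ∧ b, α ∧ β⟩ = α(a) β(b) - α(b) β(a)`. -/
def wedgePairing (e : N ≃ₗ[R] Module.Dual R M) : PairingMap R (⋀[R]^2 M) (⋀[R]^2 N) :=
  (exteriorPower.pairingDual R M 2 ∘ₗ exteriorPower.map 2 e.toLinearMap).flip

theorem wedgePairing_apply (e : N ≃ₗ[R] Module.Dual R M) (a b : M) (α β : N) :
    wedgePairing e (exteriorPower.ιMulti R 2 ![a, b]) (exteriorPower.ιMulti R 2 ![α, β]) =
      e α a * e β b - e α b * e β a := by
  simp only [wedgePairing, LinearMap.flip_apply, LinearMap.comp_apply,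
    exteriorPower.map_apply_ιMulti, exteriorPower.pairingDual_ιMulti_ιMulti]
  simp [Matrix.det_fin_two]
  ring

theorem pairingDual_bijective [Module.Free R M] [Module.Finite R M] (k : ℕ) :
    Function.Bijective (exteriorPower.pairingDual R M k) := by
  classical
  obtain ⟨n, ⟨b⟩⟩ : ∃ n : ℕ, Nonempty (Module.Basis (Fin n) R M) :=
    ⟨_, ⟨(Module.Free.chooseBasis R M).reindex (Fintype.equivFin _)⟩⟩
  let E := (b.dualBasis.exteriorPower k).equiv (b.exteriorPower k).dualBasis (Equiv.refl _)
  have hE : exteriorPower.pairingDual R M k = E.toLinearMap := by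
    refine (b.dualBasis.exteriorPower k).ext fun s => ?_
    rw [LinearEquiv.coe_coe, Module.Basis.equiv_apply, Equiv.refl_apply,
      Module.Basis.coe_dualBasis, exteriorPower.basis_coord, exteriorPower.basis_apply,
      Module.Basis.coe_dualBasis]
    rfl
  rw [hE]
  exact E.bijective

theorem wedgePairing_bijective [Module.Free R M] [Module.Finite R M]
    (e : N ≃ₗ[R] Module.Dual R M) : Function.Bijective (wedgePairing e) := by
  have hm : Function.Bijective (exteriorPower.map 2 e.toLinearMap) :=
    ⟨exteriorPower.map_injective e.symm.toLinearMap e.symm_comp,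
      exteriorPower.map_surjective e.surjective⟩
  let E : ⋀[R]^2 N ≃ₗ[R] Module.Dual R (⋀[R]^2 M) :=
    LinearEquiv.ofBijective (exteriorPower.pairingDual R M 2 ∘ₗ
      exteriorPower.map 2 e.toLinearMap) ((pairingDual_bijective 2).comp hm)
  have : wedgePairing e = ((Module.evalEquiv R (⋀[R]^2 M)) ≪≫ₗ E.dualMap).toLinearMap := rfl
  rw [this]
  exact LinearEquiv.bijective _

/-- The map `Hom(P, R) → Hom(⋀² N, R) = ⋀² M` dual to `c : ⋀² N → P`, where `M` is free of finite
rank, `N ≃ Hom(M, R)`, and `Hom(⋀² N, R)` is identified with `⋀² M` by `wedgePairing`. -/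
def dualOfWedgeMap [Module.Free R M] [Module.Finite R M] (e : N ≃ₗ[R] Module.Dual R M)
    (c : WedgeMap R N P) : DualToWedge R P M :=
  (LinearEquiv.ofBijective (wedgePairing e) (wedgePairing_bijective e)).symm.toLinearMap ∘ₗ
    c.dualMap

theorem wedgePairing_dualOfWedgeMap [Module.Free R M] [Module.Finite R M]
    (e : N ≃ₗ[R] Module.Dual R M) (c : WedgeMap R N P) (φ : Module.Dual R P) (w : ⋀[R]^2 N) :
    wedgePairing e (dualOfWedgeMap e c φ) w = φ (c w) := by
  have := (LinearEquiv.ofBijective (wedgePairing e) (wedgePairing_bijective e)).apply_symm_apply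
    (c.dualMap φ)
  exact LinearMap.congr_fun this w

end LinearAlgebra

open groupCohomology groupHomology

/-! ### Homology and cohomology of a group with trivial integer coefficients -/

/-- The trivial `G`-module `ℤ`. -/
abbrev triv (G : Type) [Group G] : Rep ℤ G := Rep.trivial ℤ G ℤ

/-- `H₁(G; ℤ)`, the abelianization of `G`, written additively. -/
abbrev HomOne (G : Type) [Group G] : Type := Additive (Abelianization G)

/-- `H₂(G; ℤ)`. -/
abbrev HomTwo (G : Type) [Group G] : Type := groupHomology.H2 (triv G)

/-- `H¹(G; ℤ)`. -/
abbrev CohOne (G : Type) [Group G] : Type := groupCohomology.H1 (triv G)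

/-- `H²(G; ℤ)`. -/
abbrev CohTwo (G : Type) [Group G] : Type := groupCohomology.H2 (triv G)

section Pairings

variable (G : Type) [Group G]

/-- The class of `g` in `H₁(G; ℤ)`. -/
def homOneMk {G : Type} [Group G] (g : G) : HomOne G := Additive.ofMul (Abelianization.of g)

/-- Homomorphisms `G → ℤ` are the same thing as linear forms on `H₁(G; ℤ)`. -/
def addHomEquivDual : (Additive G →+ ℤ) ≃ₗ[ℤ] Module.Dual ℤ (HomOne G) where
  toFun f := (MonoidHom.toAdditiveLeft
    (Abelianization.lift (AddMonoidHom.toMultiplicativeRight f))).toIntLinearMap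
  invFun φ := MonoidHom.toAdditiveLeft
    ((AddMonoidHom.toMultiplicativeRight φ.toAddMonoidHom).comp Abelianization.of)
  map_add' f g := by
    ext x
    obtain ⟨x, rfl⟩ := QuotientGroup.mk_surjective x
    rfl
  map_smul' c f := by
    ext x
    obtain ⟨x, rfl⟩ := QuotientGroup.mk_surjective x
    rfl
  left_inv f := by
    ext x
    rfl
  right_inv φ := by
    ext x
    obtain ⟨x, rfl⟩ := QuotientGroup.mk_surjective x
    rfl

theorem addHomEquivDual_apply (f : Additive G →+ ℤ) (g : G) :
    addHomEquivDual G f (homOneMk g) = f (Additive.ofMul g) := rfl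

/-- The homomorphism `G → ℤ` given by a class in `H¹(G; ℤ)`. -/
def cohOneHom : CohOne G ≃ₗ[ℤ] (Additive G →+ ℤ) := (H1IsoOfIsTrivial (triv G)).toLinearEquiv

/-- The degree one Kronecker isomorphism `H¹(G; ℤ) ≃ Hom(H₁(G; ℤ), ℤ)`. -/
def cohOneEquivDual : CohOne G ≃ₗ[ℤ] Module.Dual ℤ (HomOne G) :=
  cohOneHom G ≪≫ₗ addHomEquivDual G

theorem cohOneEquivDual_apply (f : cocycles₁ (triv G)) (g : G) :
    cohOneEquivDual G (groupCohomology.H1π (triv G) f) (homOneMk g) = f g := by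
  change (addHomEquivDual G ((H1IsoOfIsTrivial (triv G)).hom
    (groupCohomology.H1π (triv G) f))) (homOneMk g) = f g
  rw [addHomEquivDual_apply]
  exact H1IsoOfIsTrivial_H1π_apply_apply (A := triv G) f (Additive.ofMul g)

/-- The quotient map from `2`-cycles to `H₂(G; ℤ)`. -/
def cycMk : cycles₂ (triv G) →ₗ[ℤ] HomTwo G := (groupHomology.H2π (triv G)).hom

/-- The quotient map from `2`-cocycles to `H²(G; ℤ)`. -/
def cocycMk : cocycles₂ (triv G) →ₗ[ℤ] CohTwo G := (groupCohomology.H2π (triv G)).hom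

theorem cycMk_surjective : Function.Surjective (cycMk G) :=
  (ModuleCat.epi_iff_surjective (groupHomology.H2π (triv G))).1 inferInstance

theorem cocycMk_surjective : Function.Surjective (cocycMk G) :=
  (ModuleCat.epi_iff_surjective (groupCohomology.H2π (triv G))).1 inferInstance

/-- The evaluation `∑ a • x, f ↦ ∑ a * f x` of integral functions on integral chains. -/
def eval (X : Type) : (X →₀ ℤ) →ₗ[ℤ] (X → ℤ) →ₗ[ℤ] ℤ :=
  LinearMap.mk₂ ℤ (fun z f => Finsupp.linearCombination ℤ f z)
    (fun _ _ _ => map_add _ _ _) (fun _ _ _ => map_smul _ _ _)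
    (fun z f g => by simp [Finsupp.linearCombination_apply, mul_add, Finsupp.sum_add])
    (fun c z f => by
      simp only [Finsupp.linearCombination_apply, Finsupp.sum, Pi.smul_apply, smul_eq_mul,
        Finset.mul_sum]
      exact Finset.sum_congr rfl fun _ _ => by ring)

theorem eval_single (X : Type) (x : X) (a : ℤ) (f : X → ℤ) :
    eval X (Finsupp.single x a) f = a * f x :=
  Finsupp.linearCombination_single ℤ a x

/-- Evaluation of `2`-cocycles on `2`-cycles. -/
def evalTwo : cycles₂ (triv G) →ₗ[ℤ] cocycles₂ (triv G) →ₗ[ℤ] ℤ :=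
  (eval (G × G)).domRestrict₁₂ (cycles₂ (triv G)) (cocycles₂ (triv G))

theorem boundary_two_single (p : G × G) (a : ℤ) :
    ((d₂₁ (triv G)).hom : (G × G →₀ ℤ) →ₗ[ℤ] (G →₀ ℤ)) (Finsupp.single p a) =
      Finsupp.single p.2 a - Finsupp.single (p.1 * p.2) a + Finsupp.single p.1 a :=
  d₂₁_single (A := triv G) p a

theorem boundary_three_single (p : G × G × G) (a : ℤ) :
    ((d₃₂ (triv G)).hom : (G × G × G →₀ ℤ) →ₗ[ℤ] (G × G →₀ ℤ)) (Finsupp.single p a) =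
      Finsupp.single (p.2.1, p.2.2) a - Finsupp.single (p.1 * p.2.1, p.2.2) a +
        Finsupp.single (p.1, p.2.1 * p.2.2) a - Finsupp.single (p.1, p.2.1) a :=
  d₃₂_single (A := triv G) p a

theorem eval_d_two (w : G × G →₀ ℤ) (h : G → ℤ) :
    eval (G × G) w ((d₁₂ (triv G)).hom h) = eval G ((d₂₁ (triv G)).hom w) h := by
  suffices H : (eval (G × G)).flip ((d₁₂ (triv G)).hom h) =
      ((eval G).flip h) ∘ₗ (d₂₁ (triv G)).hom from LinearMap.congr_fun H w
  refine Finsupp.lhom_ext fun p a => ?_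
  have e' : (d₁₂ (triv G)).hom h p = h p.2 - h (p.1 * p.2) + h p.1 := rfl
  rw [LinearMap.comp_apply]
  refine (eval_single _ _ _ _).trans ?_
  refine Eq.trans ?_ (congrArg (fun t => eval G t h) (boundary_two_single G p a)).symm
  simp only [map_add, map_sub, LinearMap.add_apply, LinearMap.sub_apply, eval_single, e']
  ring

theorem eval_d_three (w : G × G × G →₀ ℤ) (h : G × G → ℤ) :
    eval (G × G × G) w ((d₂₃ (triv G)).hom h) = eval (G × G) ((d₃₂ (triv G)).hom w) h := by
  suffices H : (eval (G × G × G)).flip ((d₂₃ (triv G)).hom h) =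
      ((eval (G × G)).flip h) ∘ₗ (d₃₂ (triv G)).hom from LinearMap.congr_fun H w
  refine Finsupp.lhom_ext fun p a => ?_
  have e' : (d₂₃ (triv G)).hom h p = h (p.2.1, p.2.2) - h (p.1 * p.2.1, p.2.2)
      + h (p.1, p.2.1 * p.2.2) - h (p.1, p.2.1) := rfl
  rw [LinearMap.comp_apply]
  refine (eval_single _ _ _ _).trans ?_
  refine Eq.trans ?_ (congrArg (fun t => eval (G × G) t h) (boundary_three_single G p a)).symm
  simp only [map_add, map_sub, LinearMap.add_apply, LinearMap.sub_apply, eval_single, e']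
  ring

theorem evalTwo_eq_zero_left (z : cycles₂ (triv G)) (hz : cycMk G z = 0)
    (f : cocycles₂ (triv G)) : evalTwo G z f = 0 := by
  obtain ⟨w, hw⟩ := (groupHomology.H2π_eq_zero_iff z).1 hz
  have hf : (d₂₃ (triv G)).hom f.1 = 0 := f.2
  have := eval_d_three G w f.1
  rw [hf, hw] at this
  exact this.symm.trans (map_zero _)

theorem evalTwo_eq_zero_right (z : cycles₂ (triv G)) (f : cocycles₂ (triv G))
    (hf : cocycMk G f = 0) : evalTwo G z f = 0 := by
  obtain ⟨h, hh⟩ := (groupCohomology.H2π_eq_zero_iff f).1 hf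
  have hz : (d₂₁ (triv G)).hom z.1 = 0 := z.2
  have := eval_d_two G z.1 h
  rw [hz, hh] at this
  exact this.trans (by rw [map_zero]; rfl)

/-- The map `κ : H₂(G; ℤ) → Hom(H²(G; ℤ), ℤ)` of the Kronecker pairing. -/
def kronecker : PairingMap ℤ (HomTwo G) (CohTwo G) :=
  factorPairing (cycMk G) (cycMk_surjective G) (cocycMk G) (cocycMk_surjective G) (evalTwo G)
    (evalTwo_eq_zero_left G) (evalTwo_eq_zero_right G)

theorem kronecker_apply (z : cycles₂ (triv G)) (f : cocycles₂ (triv G)) :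
    kronecker G (cycMk G z) (cocycMk G f) = eval (G × G) z.1 f.1 :=
  factorPairing_apply (cycMk G) (cycMk_surjective G) (cocycMk G) (cocycMk_surjective G) (evalTwo G)
    (evalTwo_eq_zero_left G) (evalTwo_eq_zero_right G) z f

/-- The `2`-cocycle `(x, y) ↦ f x * g y`, for homomorphisms `f`, `g` from `G` to `ℤ`. -/
def cupCocycle (f g : Additive G →+ ℤ) : cocycles₂ (triv G) :=
  ⟨fun p => f (Additive.ofMul p.1) * g (Additive.ofMul p.2), by
    refine (mem_cocycles₂_def (A := triv G) _).2 fun x y z => ?_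
    change f (Additive.ofMul y) * g (Additive.ofMul z) -
        f (Additive.ofMul (x * y)) * g (Additive.ofMul z) +
        f (Additive.ofMul x) * g (Additive.ofMul (y * z)) -
        f (Additive.ofMul x) * g (Additive.ofMul y) = 0
    simp only [ofMul_mul, map_add]
    ring⟩

/-- The cup product `H¹(G; ℤ) × H¹(G; ℤ) → H²(G; ℤ)`. -/
def cupBilin : BilinMap ℤ (CohOne G) (CohTwo G) :=
  LinearMap.mk₂ ℤ (fun α β => cocycMk G (cupCocycle G (cohOneHom G α) (cohOneHom G β)))
    (fun α α' β => by
      rw [← map_add, map_add]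
      exact congrArg _ (Subtype.ext (funext fun p => add_mul _ _ _)))
    (fun c α β => by
      rw [(cohOneHom G).map_smul c α]
      exact (congrArg (cocycMk G) (Subtype.ext (funext fun p => mul_assoc _ _ _) :
        _ = c • cupCocycle G (cohOneHom G α) (cohOneHom G β))).trans ((cocycMk G).map_smul c _))
    (fun α β β' => by
      rw [← map_add, map_add]
      exact congrArg _ (Subtype.ext (funext fun p => mul_add _ _ _)))
    (fun c α β => by
      rw [(cohOneHom G).map_smul c β]
      exact (congrArg (cocycMk G) (Subtype.ext (funext fun p => mul_left_comm _ _ _) :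
        _ = c • cupCocycle G (cohOneHom G α) (cohOneHom G β))).trans ((cocycMk G).map_smul c _))

/-- The square of a degree one integral class vanishes: `(x, y) ↦ f x * f y` is the coboundary
of `x ↦ f x * (1 - f x) / 2`. -/
theorem cocycMk_cupCocycle_self (f : Additive G →+ ℤ) : cocycMk G (cupCocycle G f f) = 0 := by
  refine (groupCohomology.H2π_eq_zero_iff (A := triv G) (cupCocycle G f f)).2
    ⟨fun x => f (Additive.ofMul x) * (1 - f (Additive.ofMul x)) / 2, funext fun p => ?_⟩
  change f (Additive.ofMul p.2) * (1 - f (Additive.ofMul p.2)) / 2 -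
      f (Additive.ofMul (p.1 * p.2)) * (1 - f (Additive.ofMul (p.1 * p.2))) / 2 +
      f (Additive.ofMul p.1) * (1 - f (Additive.ofMul p.1)) / 2 =
    f (Additive.ofMul p.1) * f (Additive.ofMul p.2)
  rw [ofMul_mul, map_add]
  generalize f (Additive.ofMul p.1) = a
  generalize f (Additive.ofMul p.2) = b
  have key : ∀ c : ℤ, 2 * (c * (1 - c) / 2) = c * (1 - c) := fun c =>
    Int.mul_ediv_cancel' (by
      rcases Int.even_or_odd' c with ⟨k, rfl | rfl⟩
      · exact Dvd.intro (k * (1 - 2 * k)) (by ring)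
      · exact Dvd.intro (-((2 * k + 1) * k)) (by ring))
  have h1 := key a
  have h2 := key b
  have h3 := key (a + b)
  refine mul_left_cancel₀ (two_ne_zero (α := ℤ)) ?_
  linear_combination h2 - h3 + h1

/-- The cup product `∪ : ⋀² H¹(G; ℤ) → H²(G; ℤ)`. -/
def cup : WedgeMap ℤ (CohOne G) (CohTwo G) :=
  wedgeLift (cupBilin G) (fun α => cocycMk_cupCocycle_self G (cohOneHom G α))

theorem cup_apply (α β : CohOne G) :
    cup G (exteriorPower.ιMulti ℤ 2 ![α, β]) =
      cocycMk G (cupCocycle G (cohOneHom G α) (cohOneHom G β)) :=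
  wedgeLift_apply (cupBilin G) _ α β

/-- The map `∂ : Hom(H²(G; ℤ), ℤ) → ⋀² H₁(G; ℤ)` dual to the cup product, for a group whose first
homology is free of finite rank. -/
def dualCup [Module.Free ℤ (HomOne G)] [Module.Finite ℤ (HomOne G)] :
    DualToWedge ℤ (CohTwo G) (HomOne G) :=
  dualOfWedgeMap (cohOneEquivDual G) (cup G)

/-- The map `∂ ∘ κ : H₂(G; ℤ) → ⋀² H₁(G; ℤ)`. -/
def holonomyMap [Module.Free ℤ (HomOne G)] [Module.Finite ℤ (HomOne G)] :
    WedgeValued ℤ (HomTwo G) (HomOne G) :=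
  dualCup G ∘ₗ kronecker G

end Pairings

/-! ### Lie algebras -/

section Lie

/-- The quotient of a Lie algebra `L` by the ideal generated by a set `S`. -/
abbrev LieQuot (R L : Type*) [CommRing R] [LieRing L] [LieAlgebra R L] (S : Set L) : Type _ :=
  L ⧸ (LieSubmodule.lieSpan R L S : LieIdeal R L)

/-- The free Lie algebra `L(M)` on an `R`-module `M`: the quotient of the free Lie algebra on the
underlying set of `M` by the ideal which makes the inclusion of `M` linear. -/
def FreeLieOn (R M : Type*) [CommRing R] [AddCommGroup M] [Module R M] : Type _ :=
  LieQuot R (FreeLieAlgebra R M)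
    ({z | ∃ a b : M, z = FreeLieAlgebra.of R (a + b) -
        (FreeLieAlgebra.of R a + FreeLieAlgebra.of R b)} ∪
      {z | ∃ (c : R) (a : M), z = FreeLieAlgebra.of R (c • a) - c • FreeLieAlgebra.of R a})

variable (R M : Type*) [CommRing R] [AddCommGroup M] [Module R M]

instance : LieRing (FreeLieOn R M) :=
  inferInstanceAs (LieRing (LieQuot R (FreeLieAlgebra R M) _))

instance : LieAlgebra R (FreeLieOn R M) :=
  inferInstanceAs (LieAlgebra R (LieQuot R (FreeLieAlgebra R M) _))

/-- The inclusion of `M` as the degree one part of `L(M)`. -/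
def FreeLieOn.ι : M →ₗ[R] FreeLieOn R M where
  toFun a := LieSubmodule.Quotient.mk (FreeLieAlgebra.of R a)
  map_add' a b := (Submodule.Quotient.eq _).2
    (LieSubmodule.subset_lieSpan (Or.inl ⟨a, b, rfl⟩))
  map_smul' c a := (Submodule.Quotient.eq _).2
    (LieSubmodule.subset_lieSpan (Or.inr ⟨c, a, rfl⟩))

/-- The identification of `⋀² M` with the degree two part of `L(M)`: `a ∧ b ↦ [a, b]`. -/
def FreeLieOn.bracket : WedgeMap R M (FreeLieOn R M) :=
  wedgeLift (LinearMap.mk₂ R (fun a b => ⁅FreeLieOn.ι R M a, FreeLieOn.ι R M b⁆)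
    (fun a a' b => by simp) (fun c a b => by simp) (fun a b b' => by simp) (fun c a b => by simp))
    (fun a => lie_self (FreeLieOn.ι R M a))

/-- The quotient of `L(M)` by the ideal generated by `S`. -/
def FreeLieOnQuot (S : Set (FreeLieOn R M)) : Type _ := LieQuot R (FreeLieOn R M) S

instance (S : Set (FreeLieOn R M)) : LieRing (FreeLieOnQuot R M S) :=
  inferInstanceAs (LieRing (LieQuot R (FreeLieOn R M) S))

instance (S : Set (FreeLieOn R M)) : LieAlgebra R (FreeLieOnQuot R M S) :=
  inferInstanceAs (LieAlgebra R (LieQuot R (FreeLieOn R M) S))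

/-- The map `M → L(M) / (S)`. -/
def FreeLieOnQuot.ι (S : Set (FreeLieOn R M)) (a : M) : FreeLieOnQuot R M S :=
  LieSubmodule.Quotient.mk (FreeLieOn.ι R M a)

/-- The Lie algebra with generators `X` and relators `S`. -/
def FreeLieQuot (R X : Type*) [CommRing R] (S : Set (FreeLieAlgebra R X)) : Type _ :=
  LieQuot R (FreeLieAlgebra R X) S

instance (X : Type*) (S : Set (FreeLieAlgebra R X)) : LieRing (FreeLieQuot R X S) :=
  inferInstanceAs (LieRing (LieQuot R (FreeLieAlgebra R X) S))

instance (X : Type*) (S : Set (FreeLieAlgebra R X)) : LieAlgebra R (FreeLieQuot R X S) :=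
  inferInstanceAs (LieAlgebra R (LieQuot R (FreeLieAlgebra R X) S))

/-- The generator `x` of the Lie algebra with generators `X` and relators `S`. -/
def FreeLieQuot.of {X : Type*} (S : Set (FreeLieAlgebra R X)) (x : X) : FreeLieQuot R X S :=
  LieSubmodule.Quotient.mk (FreeLieAlgebra.of R x)

/-- In a Lie algebra generated by `V`, the span of the iterated brackets of `k` elements of `V`.
When the Lie algebra is graded with `V` as its part of degree one, this is the part of
degree `k`. -/
def lengthPart (R : Type*) {L : Type*} [CommRing R] [LieRing L] [LieAlgebra R L]
    (V : Set L) : ℕ → Submodule R L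
  | 0 => ⊥
  | 1 => Submodule.span R V
  | k + 2 => Submodule.span R {z | ∃ v ∈ V, ∃ w ∈ lengthPart R V (k + 1), z = ⁅v, w⁆}

end Lie

/-- The integral holonomy Lie algebra of a group `G` whose abelianization is free of finite rank:
the quotient of `L(H₁(G; ℤ))` by the ideal generated by the image of `∂ ∘ κ`, where `⋀² H₁(G; ℤ)`
is identified with the part of degree two of `L(H₁(G; ℤ))`. -/
def HolonomyLieAlgebra (G : Type) [Group G] [Module.Free ℤ (HomOne G)]
    [Module.Finite ℤ (HomOne G)] : Type :=
  FreeLieOnQuot ℤ (HomOne G)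
    (Set.range fun c : HomTwo G => FreeLieOn.bracket ℤ (HomOne G) (holonomyMap G c))

section HolonomyLieAlgebra

variable (G : Type) [Group G] [Module.Free ℤ (HomOne G)] [Module.Finite ℤ (HomOne G)]

instance : LieRing (HolonomyLieAlgebra G) :=
  inferInstanceAs (LieRing (FreeLieOnQuot ℤ (HomOne G) _))

instance : LieAlgebra ℤ (HolonomyLieAlgebra G) :=
  inferInstanceAs (LieAlgebra ℤ (FreeLieOnQuot ℤ (HomOne G) _))

/-- The map of `H₁(G; ℤ)` to the degree one part of the holonomy Lie algebra. -/
def HolonomyLieAlgebra.ι {G : Type} [Group G] [Module.Free ℤ (HomOne G)]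
    [Module.Finite ℤ (HomOne G)] (a : HomOne G) : HolonomyLieAlgebra G :=
  FreeLieOnQuot.ι ℤ (HomOne G) _ a

end HolonomyLieAlgebra

/-! ### Classes of relators -/

section Relators

open scoped commutatorElement

/-- The central extension of `A` by `L` with cocycle `β`, an auxiliary group for the proof of
`existsUnique_degreeTwo`. -/
structure Heis (A L : Type) [AddCommGroup A] [AddCommGroup L] (β : A →+ A →+ L) where
  /-- The first component. -/
  fst : A
  /-- The second component. -/
  snd : L

namespace Heis

variable {A L : Type} [AddCommGroup A] [AddCommGroup L] {β : A →+ A →+ L}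

@[ext]
theorem ext' {u v : Heis A L β} (h : u.fst = v.fst) (h' : u.snd = v.snd) : u = v := by
  cases u; cases v; simp_all

instance : Mul (Heis A L β) := ⟨fun u v => ⟨u.fst + v.fst, u.snd + v.snd + β u.fst v.fst⟩⟩

instance : One (Heis A L β) := ⟨⟨0, 0⟩⟩

instance : Inv (Heis A L β) := ⟨fun u => ⟨-u.fst, -u.snd + β u.fst u.fst⟩⟩

theorem mul_fst (u v : Heis A L β) : (u * v).fst = u.fst + v.fst := rfl

theorem mul_snd (u v : Heis A L β) : (u * v).snd = u.snd + v.snd + β u.fst v.fst := rfl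

theorem inv_fst (u : Heis A L β) : u⁻¹.fst = -u.fst := rfl

theorem inv_snd (u : Heis A L β) : u⁻¹.snd = -u.snd + β u.fst u.fst := rfl

theorem one_fst : (1 : Heis A L β).fst = 0 := rfl

theorem one_snd : (1 : Heis A L β).snd = 0 := rfl

instance : Group (Heis A L β) :=
  Group.ofLeftAxioms
    (fun u v w => by
      ext
      · simp only [mul_fst]; abel
      · simp only [mul_fst, mul_snd, map_add, AddMonoidHom.add_apply]; abel)
    (fun u => by
      ext
      · simp [mul_fst, one_fst]
      · simp [mul_snd, one_fst, one_snd])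
    (fun u => by
      ext
      · simp [mul_fst, inv_fst, one_fst]
      · simp [mul_snd, inv_fst, inv_snd, one_snd])

/-- The projection to `A`. -/
def proj : Heis A L β →* Multiplicative A where
  toFun u := Multiplicative.ofAdd u.fst
  map_one' := rfl
  map_mul' _ _ := rfl

theorem commutator_snd (u v : Heis A L β) :
    ⁅u, v⁆.snd = β u.fst v.fst - β v.fst u.fst := by
  simp only [commutatorElement_def, mul_fst, mul_snd, inv_fst, inv_snd, map_add, map_neg,
    AddMonoidHom.add_apply, AddMonoidHom.neg_apply]
  abel

end Heis

/-- The homomorphism `F_n → L(y_1, …, y_n)` onto the degree one part, `x_i ↦ y_i`. -/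
def linearPart (n : ℕ) : FreeGroup (Fin n) →* Multiplicative (FreeLieAlgebra ℤ (Fin n)) :=
  FreeGroup.lift fun i => Multiplicative.ofAdd (FreeLieAlgebra.of ℤ i)

/-- `Γ₃ F_n`. -/
abbrev gammaThree (n : ℕ) : Subgroup (FreeGroup (Fin n)) :=
  (⊤ : Subgroup (FreeGroup (Fin n))).lowerCentralSeries 2

/-- `gr₂ F_n = Γ₂ F_n / Γ₃ F_n`. -/
abbrev GrTwo (n : ℕ) : Type :=
  commutator (FreeGroup (Fin n)) ⧸ (gammaThree n).subgroupOf (commutator (FreeGroup (Fin n)))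

/-- A commutator as an element of the commutator subgroup. -/
def comm {G : Type} [Group G] (a b : G) : commutator G :=
  ⟨⁅a, b⁆, Subgroup.commutator_mem_commutator (Subgroup.mem_top a) (Subgroup.mem_top b)⟩

theorem exists_heis (n : ℕ) : ∃ (A : Type) (_ : AddCommGroup A)
    (β : A →+ A →+ FreeLieAlgebra ℤ (Fin n))
    (Θ : FreeGroup (Fin n) →* Heis A (FreeLieAlgebra ℤ (Fin n)) β),
    ∀ a b, β (Θ a).fst (Θ b).fst - β (Θ b).fst (Θ a).fst =
      ⁅(linearPart n a).toAdd, (linearPart n b).toAdd⁆ := by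
  let y : Fin n → FreeLieAlgebra ℤ (Fin n) := FreeLieAlgebra.of ℤ
  let β : FreeAbelianGroup (Fin n) →+ FreeAbelianGroup (Fin n) →+ FreeLieAlgebra ℤ (Fin n) :=
    FreeAbelianGroup.lift fun i => FreeAbelianGroup.lift fun j => if i < j then ⁅y i, y j⁆ else 0
  let lin : FreeAbelianGroup (Fin n) →+ FreeLieAlgebra ℤ (Fin n) := FreeAbelianGroup.lift y
  let Θ : FreeGroup (Fin n) →* Heis _ _ β := FreeGroup.lift fun i => ⟨FreeAbelianGroup.of i, 0⟩
  have hβ : ∀ a b, β a b - β b a = ⁅lin a, lin b⁆ := by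
    intro a b
    induction a using FreeAbelianGroup.induction_on with
    | zero => simp
    | of i =>
      induction b using FreeAbelianGroup.induction_on with
      | zero => simp
      | of j =>
        simp only [β, lin, FreeAbelianGroup.lift_apply_of]
        rcases lt_trichotomy i j with h | rfl | h
        · simp [h, h.not_gt]
        · simp
        · simp [h, h.not_gt]
      | neg j h => simp only [map_neg, AddMonoidHom.neg_apply, lie_neg, ← h]; abel
      | add b c hb hc =>
        simp only [map_add, AddMonoidHom.add_apply, lie_add, ← hb, ← hc]; abel
    | neg j h => simp only [map_neg, AddMonoidHom.neg_apply, neg_lie, ← h]; abel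
    | add b c hb hc =>
      simp only [map_add, AddMonoidHom.add_apply, add_lie, ← hb, ← hc]; abel
  have hlin : (AddMonoidHom.toMultiplicative lin).comp (Heis.proj.comp Θ) = linearPart n := by
    refine FreeGroup.ext_hom _ _ fun i => ?_
    simp only [MonoidHom.comp_apply, Θ, linearPart, FreeGroup.lift_apply_of]
    exact congrArg Multiplicative.ofAdd (FreeAbelianGroup.lift_apply_of y i)
  refine ⟨_, _, β, Θ, fun a b => ?_⟩
  rw [hβ, ← hlin]
  rfl

/-- There is exactly one homomorphism from `Γ₂ F_n / Γ₃ F_n` to `L(y_1, …, y_n)` which sends the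
class of a commutator `(a, b)` to the bracket of the classes of `a` and `b`. -/
theorem existsUnique_degreeTwo (n : ℕ) :
    ∃! θ : GrTwo n →* Multiplicative (FreeLieAlgebra ℤ (Fin n)), ∀ a b : FreeGroup (Fin n),
      (θ (QuotientGroup.mk (comm a b))).toAdd =
        ⁅(linearPart n a).toAdd, (linearPart n b).toAdd⁆ := by
  obtain ⟨A, _, β, Θ, h⟩ := exists_heis n
  have hfst : ∀ g ∈ commutator (FreeGroup (Fin n)), (Θ g).fst = 0 := fun g hg =>
    Abelianization.commutator_subset_ker (Heis.proj.comp Θ) hg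
  let θ₀ : commutator (FreeGroup (Fin n)) →* Multiplicative (FreeLieAlgebra ℤ (Fin n)) :=
    { toFun := fun g => Multiplicative.ofAdd (Θ g).snd
      map_one' := by
        rw [Subgroup.coe_one, map_one]
        rfl
      map_mul' := fun g g' => by
        rw [Subgroup.coe_mul, map_mul, Heis.mul_snd, hfst g g.2, map_zero,
          AddMonoidHom.zero_apply, add_zero]
        rfl }
  have hker : (gammaThree n).subgroupOf (commutator (FreeGroup (Fin n))) ≤ θ₀.ker := by
    intro g hg
    have hle : gammaThree n ≤ Θ.ker := by
      refine Subgroup.commutator_le.2 fun c hc x _ => ?_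
      have hc' : (Θ c).fst = 0 := hfst c hc
      rw [MonoidHom.mem_ker, map_commutatorElement]
      refine Heis.ext' ?_ ?_
      · rw [← map_commutatorElement]
        exact hfst ⁅c, x⁆ (comm c x).2
      · rw [Heis.commutator_snd, hc', map_zero, map_zero, AddMonoidHom.zero_apply, sub_zero]
        rfl
    have : Θ g = 1 := hle hg
    change Multiplicative.ofAdd (Θ g).snd = 1
    rw [this]
    rfl
  refine ⟨QuotientGroup.lift _ θ₀ hker, fun a b => ?_, fun ψ hψ => ?_⟩
  · change (Θ ⁅a, b⁆).snd = _
    rw [map_commutatorElement, Heis.commutator_snd, h]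
  · refine QuotientGroup.monoidHom_ext _ ?_
    refine MonoidHom.ext fun g => ?_
    obtain ⟨g, hg⟩ := g
    have hcl : g ∈ Subgroup.closure (commutatorSet (FreeGroup (Fin n))) := by
      rwa [← commutator_eq_closure]
    have key : ∀ g ∈ Subgroup.closure (commutatorSet (FreeGroup (Fin n))),
        ∀ hg : g ∈ commutator (FreeGroup (Fin n)),
          ψ (QuotientGroup.mk ⟨g, hg⟩) = θ₀ ⟨g, hg⟩ := by
      intro g hcl
      induction hcl using Subgroup.closure_induction with
      | mem x hx =>
        obtain ⟨a, b, rfl⟩ := hx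
        intro hg
        refine (hψ a b).trans ?_
        change _ = (Θ ⁅a, b⁆).snd
        rw [map_commutatorElement, Heis.commutator_snd, h]
      | one =>
        intro hg
        exact (map_one ψ).trans (map_one θ₀).symm
      | mul x y hx hy ihx ihy =>
        intro hg
        rw [← commutator_eq_closure] at hx hy
        have e : (⟨x * y, hg⟩ : commutator (FreeGroup (Fin n))) = ⟨x, hx⟩ * ⟨y, hy⟩ := rfl
        rw [e, QuotientGroup.mk_mul, map_mul, map_mul, ihx hx, ihy hy]
      | inv x hx ihx =>
        intro hg
        rw [← commutator_eq_closure] at hx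
        have e : (⟨x⁻¹, hg⟩ : commutator (FreeGroup (Fin n))) = ⟨x, hx⟩⁻¹ := rfl
        rw [e, QuotientGroup.mk_inv, map_inv, map_inv, ihx hx]
    exact key g hcl hg

/-- The identification of `gr₂ F_n = Γ₂ F_n / Γ₃ F_n` with the part of degree two of the free Lie
algebra `L(y_1, …, y_n)`: the homomorphism that sends the class of a commutator `(a, b)` to the
bracket of the classes of `a` and `b` in degree one. -/
def degreeTwo (n : ℕ) : GrTwo n →* Multiplicative (FreeLieAlgebra ℤ (Fin n)) :=
  (existsUnique_degreeTwo n).choose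

theorem degreeTwo_comm (n : ℕ) (a b : FreeGroup (Fin n)) :
    (degreeTwo n (QuotientGroup.mk (comm a b))).toAdd =
      ⁅(linearPart n a).toAdd, (linearPart n b).toAdd⁆ :=
  (existsUnique_degreeTwo n).choose_spec.1 a b

/-- The class modulo `Γ₃ F_n` of an element of `Γ₂ F_n`, as an element of `L(y_1, …, y_n)`. -/
def classModGammaThree {n : ℕ} (r : commutator (FreeGroup (Fin n))) : FreeLieAlgebra ℤ (Fin n) :=
  (degreeTwo n (QuotientGroup.mk r)).toAdd

end Relators

/-! ### Commutator-relators groups -/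

section CommutatorRelators

variable {n m : ℕ} (r : Fin m → commutator (FreeGroup (Fin n)))

/-- The group `⟨x_1, …, x_n | r_1, …, r_m⟩`, where the relators lie in the commutator subgroup of
the free group. -/
def CommRelGroup : Type :=
  PresentedGroup (Set.range fun j => (r j : FreeGroup (Fin n)))

instance : Group (CommRelGroup r) :=
  inferInstanceAs (Group (PresentedGroup (Set.range fun j => (r j : FreeGroup (Fin n)))))

/-- The generator `x_i`. -/
def CommRelGroup.x (i : Fin n) : CommRelGroup r :=
  PresentedGroup.of (rels := Set.range fun j => (r j : FreeGroup (Fin n))) i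

theorem CommRelGroup.lift_relator (ρ : FreeGroup (Fin n))
    (hρ : ρ ∈ Set.range fun j => (r j : FreeGroup (Fin n))) :
    FreeGroup.lift (fun i => Multiplicative.ofAdd (Finsupp.single i (1 : ℤ))) ρ = 1 := by
  obtain ⟨j, rfl⟩ := hρ
  exact Abelianization.commutator_subset_ker _ (r j).2

/-- The homomorphism from the abelianization to `ℤⁿ` with `x_i ↦ e_i`. -/
def CommRelGroup.toFinsupp : HomOne (CommRelGroup r) →ₗ[ℤ] (Fin n →₀ ℤ) :=
  (MonoidHom.toAdditiveLeft (Abelianization.lift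
    (PresentedGroup.toGroup (CommRelGroup.lift_relator r)))).toIntLinearMap

theorem CommRelGroup.toFinsupp_x (i : Fin n) :
    CommRelGroup.toFinsupp r (homOneMk (CommRelGroup.x r i)) = Finsupp.single i 1 :=
  congrArg Multiplicative.toAdd (PresentedGroup.toGroup.of (CommRelGroup.lift_relator r))

theorem CommRelGroup.linearCombination_toFinsupp (a : HomOne (CommRelGroup r)) :
    Finsupp.linearCombination ℤ (fun i => homOneMk (CommRelGroup.x r i))
      (CommRelGroup.toFinsupp r a) = a := by
  let ψ : HomOne (CommRelGroup r) →+ HomOne (CommRelGroup r) :=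
    (Finsupp.linearCombination ℤ (fun i => homOneMk (CommRelGroup.x r i)) ∘ₗ
      CommRelGroup.toFinsupp r).toAddMonoidHom
  have h : (AddMonoidHom.toMultiplicative ψ).comp Abelianization.of =
      (Abelianization.of : CommRelGroup r →* _) := by
    refine PresentedGroup.ext fun i => ?_
    have : ψ (homOneMk (CommRelGroup.x r i)) = homOneMk (CommRelGroup.x r i) := by
      change Finsupp.linearCombination ℤ _ (CommRelGroup.toFinsupp r _) = _
      rw [CommRelGroup.toFinsupp_x, Finsupp.linearCombination_single, one_smul]
    exact this
  obtain ⟨g, hg⟩ := QuotientGroup.mk_surjective (Additive.toMul a)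
  have := DFunLike.congr_fun h g
  change Additive.toMul (ψ (Additive.ofMul (Abelianization.of g))) = _ at this
  have ha : a = Additive.ofMul (Abelianization.of g) := hg.symm
  rw [ha]
  exact this

/-- The classes of the generators form a basis of the abelianization. -/
def CommRelGroup.basis : Module.Basis (Fin n) ℤ (HomOne (CommRelGroup r)) :=
  Module.Basis.ofRepr (LinearEquiv.ofLinearMap (CommRelGroup.toFinsupp r)
    (Finsupp.linearCombination ℤ fun i => homOneMk (CommRelGroup.x r i))
    (Finsupp.lhom_ext' fun i => LinearMap.ext_ring (by
      simp [CommRelGroup.toFinsupp_x]))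
    (LinearMap.ext (CommRelGroup.linearCombination_toFinsupp r)))

theorem CommRelGroup.basis_apply (i : Fin n) :
    CommRelGroup.basis r i = homOneMk (CommRelGroup.x r i) := by
  change Finsupp.linearCombination ℤ (fun i => homOneMk (CommRelGroup.x r i))
    (Finsupp.single i 1) = _
  rw [Finsupp.linearCombination_single, one_smul]

instance : Module.Free ℤ (HomOne (CommRelGroup r)) := .of_basis (CommRelGroup.basis r)

instance : Module.Finite ℤ (HomOne (CommRelGroup r)) := .of_basis (CommRelGroup.basis r)

/-- The Lie algebra `L(y_1, …, y_n)` modulo the ideal generated by the classes modulo `Γ₃ F_n` of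
the relators. -/
def RelatorLieAlgebra : Type :=
  FreeLieQuot ℤ (Fin n) (Set.range fun j => classModGammaThree (r j))

instance : LieRing (RelatorLieAlgebra r) :=
  inferInstanceAs (LieRing (FreeLieQuot ℤ (Fin n) _))

instance : LieAlgebra ℤ (RelatorLieAlgebra r) :=
  inferInstanceAs (LieAlgebra ℤ (FreeLieQuot ℤ (Fin n) _))

/-- The class of the generator `y_i`. -/
def RelatorLieAlgebra.y (i : Fin n) : RelatorLieAlgebra r := FreeLieQuot.of ℤ _ i

end CommutatorRelators

end Holonomy

end

/-! Write `H` for the first homology of the group, with its basis of generator classes, and `L` for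
the free Lie algebra on the `y_i`. The basis identifies `L(H)` with `L`, so it is enough to match
the two ideals. They already agree on generators: the image of `∂ ∘ κ` and the classes of the
relators have the same span in degree two.

Both sides are computed from one bilinear form `B : H × H → L`, with `B(x_i, x_j) = [y_i, y_j]` for
`i < j` and zero otherwise. Its antisymmetrization is the bracket (`upperForm_sub_swap`).

Homology side: extend `(g, h) ↦ B([g], [h])` linearly to bar 2-chains. If `α_i` is the dual basis,
the coefficient of `[y_i, y_j]` is the value of the chain on `α_i ∪ α_j`. On a cycle this is the
corresponding coordinate of `∂(κ(z))`, so the form computes the bracket image of `∂ ∘ κ`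
(`equivOfBasis_bracket_holonomyMap`).

Relator side: `B` is also a 2-cocycle defining a central extension of `H` by `L`. Lift `F_n → H` to
it by `x_i ↦ (x_i, 0)`. On `Γ₂ F_n` the second component of the lift is the class modulo `Γ₃ F_n`
(`heisLift_snd_eq_classModGammaThree`). On the kernel of `F_n → G` it lies in the span of the
relator classes, because the relators become central (`heisLift_snd_mem_relatorSpan`).

The sides are compared by Hopf's argument. A set-theoretic section of `F_n → G` writes `B` on `G ×
G` as a function valued in the relator span minus a coboundary, and the coboundary vanishes on
cycles (`chainForm_mem_relatorSpan`). Conversely, reading a relator as a word produces a 2-cycle on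
which the form takes the relator's class (`exists_chain`, `exists_cycle`). -/

noncomputable section

namespace Holonomy

/-! ### Quotients of Lie algebras, the free Lie algebra on a module, and bracket length. -/

section LieLemmas

variable {R L L' M X : Type*} [CommRing R] [LieRing L] [LieAlgebra R L] [LieRing L']
  [LieAlgebra R L'] [AddCommGroup M] [Module R M]

/-- The homomorphism from `L / (S)` induced by a homomorphism from `L` that vanishes on `S`. -/
def LieQuot.lift {S : Set L} (f : L →ₗ⁅R⁆ L') (h : ∀ s ∈ S, f s = 0) : LieQuot R L S →ₗ⁅R⁆ L' :=
  { ((LieSubmodule.lieSpan R L S : LieIdeal R L).toSubmodule).liftQ f.toLinearMap (by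
      have : (LieSubmodule.lieSpan R L S : LieIdeal R L) ≤ f.ker :=
        LieSubmodule.lieSpan_le.2 fun s hs => LieHom.mem_ker.2 (h s hs)
      exact fun x hx => LieHom.mem_ker.1 (this hx)) with
    map_lie' := by
      intro x y
      obtain ⟨x, rfl⟩ := Submodule.Quotient.mk_surjective _ x
      obtain ⟨y, rfl⟩ := Submodule.Quotient.mk_surjective _ y
      exact f.map_lie x y }

/-- The quotient map `L → L / (S)`. -/
def LieQuot.mkHom (S : Set L) : L →ₗ⁅R⁆ LieQuot R L S :=
  { ((LieSubmodule.lieSpan R L S : LieIdeal R L).toSubmodule).mkQ with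
    map_lie' := rfl }

theorem LieQuot.mkHom_eq_zero {S : Set L} {x : L}
    (hx : x ∈ (LieSubmodule.lieSpan R L S : LieIdeal R L)) : LieQuot.mkHom (R := R) S x = 0 :=
  (Submodule.Quotient.mk_eq_zero _).2 hx

/-- The isomorphism `L / (S) ≃ L' / (S')` induced by an isomorphism `L ≃ L'` that matches the ideals
generated by `S` and `S'`. -/
def LieQuot.congr {S : Set L} {S' : Set L'} (e : L ≃ₗ⁅R⁆ L')
    (h : ∀ s ∈ S, e s ∈ (LieSubmodule.lieSpan R L' S' : LieIdeal R L'))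
    (h' : ∀ s ∈ S', e.symm s ∈ (LieSubmodule.lieSpan R L S : LieIdeal R L)) :
    LieQuot R L S ≃ₗ⁅R⁆ LieQuot R L' S' :=
  { LieQuot.lift ((LieQuot.mkHom S').comp e.toLieHom)
      (fun s hs => LieQuot.mkHom_eq_zero (h s hs)) with
    invFun := LieQuot.lift ((LieQuot.mkHom S).comp e.symm.toLieHom)
      (fun s hs => LieQuot.mkHom_eq_zero (h' s hs))
    left_inv := fun x => by
      obtain ⟨x, rfl⟩ := Submodule.Quotient.mk_surjective _ x
      exact congrArg (LieQuot.mkHom S) (e.symm_apply_apply x)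
    right_inv := fun x => by
      obtain ⟨x, rfl⟩ := Submodule.Quotient.mk_surjective _ x
      exact congrArg (LieQuot.mkHom S') (e.apply_symm_apply x) }

/-- The homomorphism `L(M) → L` that extends a linear map `M → L`. -/
def FreeLieOn.lift (f : M →ₗ[R] L) : FreeLieOn R M →ₗ⁅R⁆ L :=
  LieQuot.lift (FreeLieAlgebra.lift R f) (by
    rintro _ (⟨a, b, rfl⟩ | ⟨c, a, rfl⟩) <;> simp)

theorem FreeLieOn.lift_ι (f : M →ₗ[R] L) (a : M) : FreeLieOn.lift f (FreeLieOn.ι R M a) = f a :=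
  FreeLieAlgebra.lift_of_apply (R := R) f a

theorem FreeLieOn.hom_ext {f g : FreeLieOn R M →ₗ⁅R⁆ L}
    (h : ∀ a, f (FreeLieOn.ι R M a) = g (FreeLieOn.ι R M a)) : f = g := by
  have : f.comp (LieQuot.mkHom (R := R) _) = g.comp (LieQuot.mkHom (R := R) _) :=
    FreeLieAlgebra.hom_ext h
  refine LieHom.ext fun x => ?_
  obtain ⟨x, rfl⟩ := Submodule.Quotient.mk_surjective _ x
  exact LieHom.congr_fun this x

/-- A basis of `M` identifies `L(M)` with the free Lie algebra on the index set of the basis. -/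
def FreeLieOn.equivOfBasis (b : Module.Basis X R M) : FreeLieOn R M ≃ₗ⁅R⁆ FreeLieAlgebra R X :=
  let f : FreeLieOn R M →ₗ⁅R⁆ FreeLieAlgebra R X :=
    FreeLieOn.lift (b.constr R (FreeLieAlgebra.of R))
  let g : FreeLieAlgebra R X →ₗ⁅R⁆ FreeLieOn R M :=
    FreeLieAlgebra.lift R fun i => FreeLieOn.ι R M (b i)
  { f with
    invFun := g
    left_inv := fun x => by
      have hl : g.toLinearMap ∘ₗ (b.constr R (FreeLieAlgebra.of R)) = FreeLieOn.ι R M :=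
        b.ext fun i => by
          rw [LinearMap.comp_apply, b.constr_basis]
          exact FreeLieAlgebra.lift_of_apply (R := R) (fun i => FreeLieOn.ι R M (b i)) i
      have : g.comp f = LieHom.id := FreeLieOn.hom_ext fun a => by
        rw [LieHom.comp_apply, FreeLieOn.lift_ι]
        exact LinearMap.congr_fun hl a
      exact LieHom.congr_fun this x
    right_inv := fun x => by
      have : f.comp g = LieHom.id := FreeLieAlgebra.hom_ext fun i => by
        rw [LieHom.comp_apply, FreeLieAlgebra.lift_of_apply, FreeLieOn.lift_ι, b.constr_basis]
        rfl
      exact LieHom.congr_fun this x }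

theorem FreeLieOn.equivOfBasis_ι (b : Module.Basis X R M) (a : M) :
    FreeLieOn.equivOfBasis b (FreeLieOn.ι R M a) = b.constr R (FreeLieAlgebra.of R) a :=
  FreeLieOn.lift_ι _ a

theorem FreeLieOn.bracket_apply (a a' : M) :
    FreeLieOn.bracket R M (exteriorPower.ιMulti R 2 ![a, a']) =
      ⁅FreeLieOn.ι R M a, FreeLieOn.ι R M a'⁆ :=
  wedgeLift_apply _ _ a a'

/-- The bracket is linear in its left argument, so only the span of the degree one generators
matters. This allows all of `H₁` to be replaced by the classes of the generators. -/
theorem lengthPart_eq_of_span_eq {V W : Set L} (h : Submodule.span R V = Submodule.span R W)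
    (k : ℕ) : lengthPart R V k = lengthPart R W k := by
  have le : ∀ {V W : Set L}, Submodule.span R V = Submodule.span R W → ∀ P : Submodule R L,
      Submodule.span R {z | ∃ v ∈ V, ∃ w ∈ P, z = ⁅v, w⁆} ≤
        Submodule.span R {z | ∃ v ∈ W, ∃ w ∈ P, z = ⁅v, w⁆} := by
    intro V W h P
    refine Submodule.span_le.2 ?_
    rintro _ ⟨v, hv, w, hw, rfl⟩
    have hv' : v ∈ Submodule.span R W := h ▸ Submodule.subset_span hv
    -- Dropped so that the induction on the span does not carry the hypothesis `v ∈ V`.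
    clear hv
    change ⁅v, w⁆ ∈ Submodule.span R _
    induction hv' using Submodule.span_induction with
    | mem x hx => exact Submodule.subset_span ⟨x, hx, w, hw, rfl⟩
    | zero => rw [zero_lie]; exact Submodule.zero_mem _
    | add x y _ _ hx hy => rw [add_lie]; exact Submodule.add_mem _ hx hy
    | smul c x _ hx => rw [smul_lie]; exact Submodule.smul_mem _ c hx
  match k with
  | 0 => rfl
  | 1 => exact h
  | k + 2 =>
    simp only [lengthPart, lengthPart_eq_of_span_eq h (k + 1)]
    exact le_antisymm (le h _) (le h.symm _)

theorem map_lengthPart (f : L →ₗ⁅R⁆ L') (V : Set L) (k : ℕ) :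
    (lengthPart R V k).map f.toLinearMap = lengthPart R (f '' V) k := by
  match k with
  | 0 => exact Submodule.map_bot _
  | 1 => exact Submodule.map_span _ _
  | k + 2 =>
    simp only [lengthPart, ← map_lengthPart f V (k + 1), Submodule.map_span]
    congr 1
    ext z
    constructor
    · rintro ⟨_, ⟨v, hv, w, hw, rfl⟩, rfl⟩
      exact ⟨f v, ⟨v, hv, rfl⟩, f w, ⟨w, hw, rfl⟩, f.map_lie v w⟩
    · rintro ⟨_, ⟨v, hv, rfl⟩, _, ⟨w, hw, rfl⟩, rfl⟩
      exact ⟨⁅v, w⁆, ⟨v, hv, w, hw, rfl⟩, f.map_lie v w⟩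

end LieLemmas

/-! ### A bilinear form whose antisymmetrization is the bracket. -/

section UpperForm

variable {R M : Type*} [CommRing R] [AddCommGroup M] [Module R M] {n : ℕ}
  (b : Module.Basis (Fin n) R M)

/-- The bilinear map with `(b i, b j) ↦ [y_i, y_j]` for `i < j` and `(b i, b j) ↦ 0` otherwise. -/
def upperForm : BilinMap R M (FreeLieAlgebra R (Fin n)) :=
  b.constr R fun i => b.constr R fun j =>
    if i < j then ⁅FreeLieAlgebra.of R i, FreeLieAlgebra.of R j⁆ else 0

theorem upperForm_basis (i j : Fin n) : upperForm b (b i) (b j) =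
    if i < j then ⁅FreeLieAlgebra.of R i, FreeLieAlgebra.of R j⁆ else 0 := by
  simp only [upperForm, Module.Basis.constr_basis]

theorem upperForm_apply (a a' : M) : upperForm b a a' =
    ∑ i, ∑ j, (b.coord i a * b.coord j a') • upperForm b (b i) (b j) := by
  conv_lhs => rw [← b.sum_repr a, ← b.sum_repr a']
  simp only [map_sum, LinearMap.sum_apply, map_smul, LinearMap.smul_apply, Finset.smul_sum,
    mul_smul, Module.Basis.coord_apply]
  rw [Finset.sum_comm]
  exact Finset.sum_congr rfl fun i _ => Finset.sum_congr rfl fun j _ => smul_comm _ _ _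

/-- By bilinearity it suffices to check pairs of basis vectors: exactly one of the two terms
survives when `i ≠ j`, and both sides vanish when `i = j`. -/
theorem upperForm_sub_swap (a a' : M) : upperForm b a a' - upperForm b a' a =
    ⁅b.constr R (FreeLieAlgebra.of R) a, b.constr R (FreeLieAlgebra.of R) a'⁆ := by
  let B : BilinMap R M (FreeLieAlgebra R (Fin n)) :=
    LinearMap.mk₂ R (fun a a' =>
      ⁅b.constr R (FreeLieAlgebra.of R) a, b.constr R (FreeLieAlgebra.of R) a'⁆)
      (fun a a' c => by simp only [map_add, add_lie]) (fun t a c => by simp only [map_smul, smul_lie])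
      (fun a c c' => by simp only [map_add, lie_add]) (fun t a c => by simp only [map_smul, lie_smul])
  have : upperForm b - (upperForm b).flip = B := by
    refine b.ext fun i => b.ext fun j => ?_
    simp only [B, LinearMap.sub_apply, LinearMap.flip_apply, upperForm_basis, LinearMap.mk₂_apply,
      Module.Basis.constr_basis]
    rcases lt_trichotomy i j with h | rfl | h
    · simp [h, h.not_gt]
    · simp
    · simp [h, h.not_gt]
  exact LinearMap.congr_fun₂ this a a'

/-- Pairing with `α_i ∧ α_j`, for the dual basis `α`, reads off the coordinates of `ω`. The sum may
run over all `i, j` because the form vanishes on basis pairs unless `i < j`. -/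
theorem equivOfBasis_bracket_eq_sum {N : Type*} [AddCommGroup N] [Module R N]
    (e : N ≃ₗ[R] Module.Dual R M) (ω : ⋀[R]^2 M) :
    FreeLieOn.equivOfBasis b (FreeLieOn.bracket R M ω) =
      ∑ i, ∑ j, wedgePairing e ω
        (exteriorPower.ιMulti R 2 ![e.symm (b.coord i), e.symm (b.coord j)]) •
          upperForm b (b i) (b j) := by
  let F : ⋀[R]^2 M →ₗ[R] FreeLieAlgebra R (Fin n) :=
    (FreeLieOn.equivOfBasis b).toLinearEquiv.toLinearMap ∘ₗ FreeLieOn.bracket R M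
  let F' : ⋀[R]^2 M →ₗ[R] FreeLieAlgebra R (Fin n) :=
    ∑ i, ∑ j, ((wedgePairing e).flip
      (exteriorPower.ιMulti R 2 ![e.symm (b.coord i), e.symm (b.coord j)])).smulRight
        (upperForm b (b i) (b j))
  have hF' : ∀ ω, F' ω = ∑ i, ∑ j, wedgePairing e ω
      (exteriorPower.ιMulti R 2 ![e.symm (b.coord i), e.symm (b.coord j)]) •
        upperForm b (b i) (b j) := fun ω => by
    simp only [F', LinearMap.sum_apply, LinearMap.smulRight_apply, LinearMap.flip_apply]
  have : F = F' := by
    refine exteriorPower.linearMap_ext (AlternatingMap.ext fun v => ?_)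
    obtain ⟨a, a', rfl⟩ : ∃ a a', v = ![a, a'] := ⟨v 0, v 1, by ext i; fin_cases i <;> rfl⟩
    have h1 : F (exteriorPower.ιMulti R 2 ![a, a']) =
        upperForm b a a' - upperForm b a' a := by
      rw [upperForm_sub_swap, ← FreeLieOn.equivOfBasis_ι, ← FreeLieOn.equivOfBasis_ι,
        ← LieEquiv.map_lie, ← FreeLieOn.bracket_apply]
      rfl
    change F (exteriorPower.ιMulti R 2 ![a, a']) = F' (exteriorPower.ιMulti R 2 ![a, a'])
    -- The two terms of the determinant in `wedgePairing_apply` are the coefficients of the form at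
    -- `(a, a')` and at `(a', a)`.
    rw [h1, hF', upperForm_apply, upperForm_apply b a' a]
    simp only [wedgePairing_apply, LinearEquiv.apply_symm_apply, sub_smul, Finset.sum_sub_distrib]
  rw [← hF', ← this]
  rfl

end UpperForm

/-! ### The form on 2-chains and its relation to the cup product. -/

section Chains

open groupHomology

variable {G : Type} [Group G] {n : ℕ} (b : Module.Basis (Fin n) ℤ (HomOne G))

theorem homOneMk_one : homOneMk (1 : G) = 0 := by
  simp only [homOneMk, map_one, ofMul_one]

theorem homOneMk_inv (g : G) : homOneMk g⁻¹ = -homOneMk g := by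
  simp only [homOneMk, map_inv, ofMul_inv]

/-- The value of `upperForm` on a `2`-chain. -/
def chainForm : (G × G →₀ ℤ) →ₗ[ℤ] FreeLieAlgebra ℤ (Fin n) :=
  Finsupp.linearCombination ℤ fun p => upperForm b (homOneMk p.1) (homOneMk p.2)

theorem chainForm_single (p : G × G) (c : ℤ) :
    chainForm b (Finsupp.single p c) = c • upperForm b (homOneMk p.1) (homOneMk p.2) :=
  Finsupp.linearCombination_single ℤ c p

theorem cupCocycle_cohOneHom_apply (α β : CohOne G) (p : G × G) :
    (cupCocycle G (cohOneHom G α) (cohOneHom G β)).1 p =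
      cohOneEquivDual G α (homOneMk p.1) * cohOneEquivDual G β (homOneMk p.2) := rfl

/-- On a single pair `(g, h)`, the product of coordinates in `upperForm_apply` is the value there of
the cup product cocycle of `α_i` and `α_j`. -/
theorem chainForm_eq_sum (z : G × G →₀ ℤ) : chainForm b z =
    ∑ i, ∑ j, eval (G × G) z (cupCocycle G (cohOneHom G ((cohOneEquivDual G).symm (b.coord i)))
      (cohOneHom G ((cohOneEquivDual G).symm (b.coord j)))).1 • upperForm b (b i) (b j) := by
  let F : (G × G →₀ ℤ) →ₗ[ℤ] FreeLieAlgebra ℤ (Fin n) :=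
    ∑ i, ∑ j, ((eval (G × G)).flip
      (cupCocycle G (cohOneHom G ((cohOneEquivDual G).symm (b.coord i)))
        (cohOneHom G ((cohOneEquivDual G).symm (b.coord j)))).1).smulRight
          (upperForm b (b i) (b j))
  have hF : ∀ z, F z = ∑ i, ∑ j, eval (G × G) z
      (cupCocycle G (cohOneHom G ((cohOneEquivDual G).symm (b.coord i)))
        (cohOneHom G ((cohOneEquivDual G).symm (b.coord j)))).1 • upperForm b (b i) (b j) :=
    fun z => by
      simp only [F, LinearMap.sum_apply, LinearMap.smulRight_apply, LinearMap.flip_apply]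
  rw [← hF]
  suffices H : chainForm b = F from LinearMap.congr_fun H z
  refine Finsupp.lhom_ext fun p c => ?_
  rw [hF, chainForm_single, upperForm_apply]
  simp only [eval_single, cupCocycle_cohOneHom_apply, LinearEquiv.apply_symm_apply,
    Finset.smul_sum]
  exact Finset.sum_congr rfl fun i _ => Finset.sum_congr rfl fun j _ => (mul_smul _ _ _).symm

/-- The image of the class of a `2`-cycle under `∂ ∘ κ`, in the free Lie algebra on a basis of the
first homology. -/
theorem equivOfBasis_bracket_holonomyMap [Module.Free ℤ (HomOne G)] [Module.Finite ℤ (HomOne G)]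
    (z : cycles₂ (triv G)) :
    FreeLieOn.equivOfBasis b (FreeLieOn.bracket ℤ (HomOne G) (holonomyMap G (cycMk G z))) =
      chainForm b z.1 := by
  rw [equivOfBasis_bracket_eq_sum b (cohOneEquivDual G), chainForm_eq_sum]
  refine Finset.sum_congr rfl fun i _ => Finset.sum_congr rfl fun j _ => ?_
  congr 1
  -- Duality of `∂` and the cup product turns the coefficient into `κ(z)` evaluated on `α_i ∪ α_j`.
  refine (wedgePairing_dualOfWedgeMap (cohOneEquivDual G) (cup G) _ _).trans ?_
  rw [cup_apply]
  exact kronecker_apply G z _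

end Chains

/-! ### The central extension and the relators. -/

section CommutatorRelatorsLemmas

open groupHomology
open scoped commutatorElement

variable {n m : ℕ} (r : Fin m → commutator (FreeGroup (Fin n)))

namespace CommRelGroup

/-- The projection of the free group onto the presented group. -/
def proj : FreeGroup (Fin n) →* CommRelGroup r :=
  PresentedGroup.mk (Set.range fun j => (r j : FreeGroup (Fin n)))

theorem proj_surjective : Function.Surjective (proj r) :=
  PresentedGroup.mk_surjective _

theorem proj_of (i : Fin n) : proj r (FreeGroup.of i) = x r i := rfl

theorem proj_eq_one_iff (w : FreeGroup (Fin n)) :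
    proj r w = 1 ↔ w ∈ Subgroup.normalClosure (Set.range fun j => (r j : FreeGroup (Fin n))) :=
  QuotientGroup.eq_one_iff w

/-- The bilinear form with `(x_i, x_j) ↦ [y_i, y_j]` for `i < j` and `(x_i, x_j) ↦ 0` otherwise. -/
def form : HomOne (CommRelGroup r) →+ HomOne (CommRelGroup r) →+ FreeLieAlgebra ℤ (Fin n) :=
  LinearMap.toAddMonoidHom'.comp (upperForm (basis r)).toAddMonoidHom

theorem form_apply (a a' : HomOne (CommRelGroup r)) : form r a a' = upperForm (basis r) a a' := rfl

/-- The lift of the projection `F_n → H₁` to the central extension of `H₁` by the free Lie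
algebra. -/
def heisLift : FreeGroup (Fin n) →* Heis _ _ (form r) :=
  FreeGroup.lift fun i => ⟨homOneMk (x r i), 0⟩

theorem heisLift_of (i : Fin n) : heisLift r (FreeGroup.of i) = ⟨homOneMk (x r i), 0⟩ :=
  FreeGroup.lift_apply_of

theorem heisLift_fst (w : FreeGroup (Fin n)) : (heisLift r w).fst = homOneMk (proj r w) := by
  have : (Heis.proj (β := form r)).comp (heisLift r) =
      (AddMonoidHom.toMultiplicative (AddMonoidHom.id _)).comp
        ((Abelianization.of).comp (proj r)) := by
    refine FreeGroup.ext_hom _ _ fun i => ?_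
    rw [MonoidHom.comp_apply, heisLift_of]
    rfl
  exact congrArg Multiplicative.toAdd (DFunLike.congr_fun this w)

theorem heisLift_snd_mul (v w : FreeGroup (Fin n)) : (heisLift r (v * w)).snd =
    (heisLift r v).snd + (heisLift r w).snd +
      upperForm (basis r) (homOneMk (proj r v)) (homOneMk (proj r w)) := by
  rw [map_mul, Heis.mul_snd, heisLift_fst, heisLift_fst, form_apply]

theorem heisLift_fst_of_mem_commutator {w : FreeGroup (Fin n)}
    (hw : w ∈ commutator (FreeGroup (Fin n))) : (heisLift r w).fst = 0 :=
  Abelianization.commutator_subset_ker ((Heis.proj (β := form r)).comp (heisLift r)) hw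

theorem constr_homOneMk_proj (w : FreeGroup (Fin n)) :
    (basis r).constr ℤ (FreeLieAlgebra.of ℤ) (homOneMk (proj r w)) =
      (linearPart n w).toAdd := by
  have : (AddMonoidHom.toMultiplicative
      ((basis r).constr ℤ (FreeLieAlgebra.of ℤ)).toAddMonoidHom).comp
        ((Abelianization.of).comp (proj r)) = linearPart n := by
    refine FreeGroup.ext_hom _ _ fun i => ?_
    rw [linearPart, FreeGroup.lift_apply_of, ← (basis r).constr_basis ℤ (FreeLieAlgebra.of ℤ) i,
      basis_apply]
    rfl
  exact congrArg Multiplicative.toAdd (DFunLike.congr_fun this w)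

theorem heisLift_snd_commutator (v w : FreeGroup (Fin n)) : (heisLift r ⁅v, w⁆).snd =
    ⁅(linearPart n v).toAdd, (linearPart n w).toAdd⁆ := by
  rw [map_commutatorElement, Heis.commutator_snd, form_apply, form_apply, upperForm_sub_swap,
    heisLift_fst, heisLift_fst]
  exact congrArg₂ _ (constr_homOneMk_proj r v) (constr_homOneMk_proj r w)

/-- On `Γ₂ F_n` the first component of the lift vanishes, so the second is multiplicative there.
Both sides are then homomorphisms that agree on commutators, which generate. -/
theorem heisLift_snd_eq_classModGammaThree (ρ : commutator (FreeGroup (Fin n))) :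
    (heisLift r ρ).snd = classModGammaThree ρ := by
  obtain ⟨w, hw⟩ := ρ
  have hcl : w ∈ Subgroup.closure (commutatorSet (FreeGroup (Fin n))) := by
    rwa [← commutator_eq_closure]
  have key : ∀ w ∈ Subgroup.closure (commutatorSet (FreeGroup (Fin n))),
      ∀ hw : w ∈ commutator (FreeGroup (Fin n)),
        (heisLift r w).snd = classModGammaThree ⟨w, hw⟩ := by
    intro w hcl
    induction hcl using Subgroup.closure_induction with
    | mem w h =>
      obtain ⟨a, b, rfl⟩ := h
      intro hw
      rw [heisLift_snd_commutator]
      exact (degreeTwo_comm n a b).symm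
    | one =>
      intro hw
      rw [map_one]
      exact (congrArg Multiplicative.toAdd (map_one (degreeTwo n))).symm
    | mul v w hv hw ihv ihw =>
      intro hvw
      rw [← commutator_eq_closure] at hv hw
      rw [map_mul, Heis.mul_snd, heisLift_fst_of_mem_commutator r hv, map_zero,
        AddMonoidHom.zero_apply, add_zero, ihv hv, ihw hw]
      exact (congrArg Multiplicative.toAdd (map_mul (degreeTwo n)
        (QuotientGroup.mk ⟨v, hv⟩) (QuotientGroup.mk ⟨w, hw⟩))).symm
    | inv w hw ih =>
      intro hw'
      rw [← commutator_eq_closure] at hw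
      rw [map_inv, Heis.inv_snd, heisLift_fst_of_mem_commutator r hw, map_zero, add_zero, ih hw]
      exact (congrArg Multiplicative.toAdd (map_inv (degreeTwo n)
        (QuotientGroup.mk ⟨w, hw⟩))).symm
  exact key w hcl hw

/-- The span of the classes of the relators. -/
def relatorSpan : Submodule ℤ (FreeLieAlgebra ℤ (Fin n)) :=
  Submodule.span ℤ (Set.range fun j => classModGammaThree (r j))

/-- The kernel is generated by conjugates of relators, and conjugation has no effect on their
central images. The vanishing of the first component is carried along so that second components add
in the induction. -/
theorem heisLift_snd_mem_relatorSpan {w : FreeGroup (Fin n)} (hw : proj r w = 1) :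
    (heisLift r w).snd ∈ relatorSpan r := by
  rw [proj_eq_one_iff, Subgroup.normalClosure] at hw
  suffices (heisLift r w).fst = 0 ∧ (heisLift r w).snd ∈ relatorSpan r from this.2
  induction hw using Subgroup.closure_induction with
  | mem w h =>
    obtain ⟨_, ⟨j, rfl⟩, h⟩ := Group.mem_conjugatesOfSet_iff.1 h
    obtain ⟨g, rfl⟩ := isConj_iff.1 h
    have hj := heisLift_fst_of_mem_commutator r (r j).2
    -- An element with first component zero is central, since the cocycle vanishes when either
    -- argument is zero.
    have : heisLift r (g * r j * g⁻¹) = heisLift r (r j) := by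
      rw [map_mul, map_mul, map_inv, mul_inv_eq_iff_eq_mul]
      refine Heis.ext' ?_ ?_
      · simp only [Heis.mul_fst, hj, add_comm]
      · simp only [Heis.mul_snd, hj, map_zero, AddMonoidHom.zero_apply, add_comm]
    rw [this]
    refine ⟨hj, ?_⟩
    rw [heisLift_snd_eq_classModGammaThree]
    exact Submodule.subset_span ⟨j, rfl⟩
  | one =>
    rw [map_one]
    exact ⟨rfl, Submodule.zero_mem _⟩
  | mul v w _ _ hv hw =>
    rw [map_mul, Heis.mul_fst, Heis.mul_snd, hv.1, hw.1, add_zero, map_zero, add_zero]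
    exact ⟨rfl, Submodule.add_mem _ hv.2 hw.2⟩
  | inv w _ hw =>
    rw [map_inv, Heis.inv_fst, Heis.inv_snd, hw.1, neg_zero, map_zero, add_zero]
    exact ⟨rfl, Submodule.neg_mem _ hw.2⟩

/-- The value of the form on a `2`-cycle is a combination of the classes of the relators. -/
theorem chainForm_mem_relatorSpan (z : cycles₂ (triv (CommRelGroup r))) :
    chainForm (basis r) z.1 ∈ relatorSpan r := by
  choose s hs using proj_surjective r
  let u : CommRelGroup r × CommRelGroup r → FreeLieAlgebra ℤ (Fin n) := fun p =>
    (heisLift r (s p.1 * s p.2 * (s (p.1 * p.2))⁻¹)).snd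
  have hu : ∀ p, u p ∈ relatorSpan r := fun p =>
    heisLift_snd_mem_relatorSpan r (by simp only [map_mul, map_inv, hs, mul_inv_cancel])
  -- Compare two factorizations of `s(g) s(h)`: as it stands, and as a kernel element times `s(gh)`.
  -- The second contributes no form term, since the kernel element is trivial in `H₁`.
  have hform : ∀ p : CommRelGroup r × CommRelGroup r,
      upperForm (basis r) (homOneMk p.1) (homOneMk p.2) = u p -
        ((heisLift r (s p.2)).snd - (heisLift r (s (p.1 * p.2))).snd +
          (heisLift r (s p.1)).snd) := fun p => by
    have h1 := heisLift_snd_mul r (s p.1) (s p.2)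
    have h2 := heisLift_snd_mul r (s p.1 * s p.2 * (s (p.1 * p.2))⁻¹) (s (p.1 * p.2))
    have h3 : proj r (s p.1 * s p.2 * (s (p.1 * p.2))⁻¹) = 1 := by
      simp only [map_mul, map_inv, hs, mul_inv_cancel]
    rw [inv_mul_cancel_right, h3, homOneMk_one, map_zero, LinearMap.zero_apply, add_zero, h1,
      hs, hs] at h2
    rw [eq_sub_iff_add_eq, ← sub_eq_zero]
    rw [← sub_eq_zero] at h2
    rw [← h2]
    abel
  have hd : ((d₂₁ (triv (CommRelGroup r))).hom :
      (CommRelGroup r × CommRelGroup r →₀ ℤ) →ₗ[ℤ] (CommRelGroup r →₀ ℤ)) z.1 = 0 := z.2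
  have H : chainForm (basis r) = Finsupp.linearCombination ℤ u -
      (Finsupp.linearCombination ℤ fun g => (heisLift r (s g)).snd) ∘ₗ
        ((d₂₁ (triv (CommRelGroup r))).hom :
          (CommRelGroup r × CommRelGroup r →₀ ℤ) →ₗ[ℤ] (CommRelGroup r →₀ ℤ)) := by
    refine Finsupp.lhom_ext fun p c => ?_
    rw [chainForm_single, hform, LinearMap.sub_apply, LinearMap.comp_apply,
      boundary_two_single, map_add, map_sub]
    simp only [Finsupp.linearCombination_single, smul_sub, smul_add]
  -- The correction term factors through the boundary, so it dies on a cycle.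
  rw [H, LinearMap.sub_apply, LinearMap.comp_apply, hd, map_zero, sub_zero]
  exact Submodule.sum_mem _ fun p _ => Submodule.smul_mem _ _ (hu p)

/-! ### Cycles realizing the relators. -/

/-- The homomorphism from `F_n` to the group of `1`-chains that sends each generator to its
class. -/
def oneChain : FreeGroup (Fin n) →* Multiplicative (CommRelGroup r →₀ ℤ) :=
  FreeGroup.lift fun i => Multiplicative.ofAdd (Finsupp.single (x r i) 1)

/-- The chain records how the word `w` is multiplied out in `G`: its boundary compares the sum of
the letters with the product, and the form accumulates the cocycle terms of the lift. -/
theorem exists_chain (w : FreeGroup (Fin n)) :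
    ∃ c : CommRelGroup r × CommRelGroup r →₀ ℤ,
      ((d₂₁ (triv (CommRelGroup r))).hom :
        (CommRelGroup r × CommRelGroup r →₀ ℤ) →ₗ[ℤ] (CommRelGroup r →₀ ℤ)) c =
          (oneChain r w).toAdd - Finsupp.single (proj r w) 1 ∧
      chainForm (basis r) c = (heisLift r w).snd := by
  induction w using FreeGroup.induction_on with
  | C1 =>
    refine ⟨-Finsupp.single (1, 1) 1, ?_, ?_⟩
    · rw [map_neg, boundary_two_single, map_one (proj r), map_one (oneChain r), mul_one, toAdd_one]
      abel
    · rw [map_neg, chainForm_single, homOneMk_one, map_zero, smul_zero, neg_zero, map_one]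
      rfl
  | of i =>
    refine ⟨0, ?_, ?_⟩
    · rw [map_zero, oneChain, FreeGroup.lift_apply_of, proj_of, toAdd_ofAdd, sub_self]
    · rw [map_zero, heisLift_of]
  | inv_of i h =>
    obtain ⟨c, hc, hc'⟩ := h
    -- The boundary of `(g, g⁻¹)` is `g⁻¹ - 1 + g`. Since `(1, 1)` has boundary the chain `1`,
    -- subtracting it as well removes the leftover unit; the form vanishes on it.
    refine ⟨-c - Finsupp.single (proj r (FreeGroup.of i), (proj r (FreeGroup.of i))⁻¹) 1 -
      Finsupp.single (1, 1) 1, ?_, ?_⟩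
    · rw [map_sub, map_sub, map_neg, hc, boundary_two_single, boundary_two_single, map_inv (proj r),
        map_inv (oneChain r), toAdd_inv, mul_inv_cancel, mul_one]
      abel
    · rw [map_sub, map_sub, map_neg, hc', chainForm_single, chainForm_single, map_inv,
        Heis.inv_snd, heisLift_fst, form_apply, homOneMk_one, homOneMk_inv, map_neg, map_zero,
        one_smul, smul_zero, sub_zero, sub_neg_eq_add]
  | mul v w hv hw =>
    obtain ⟨c, hc, hc'⟩ := hv
    obtain ⟨d, hd, hd'⟩ := hw
    refine ⟨c + d + Finsupp.single (proj r v, proj r w) 1, ?_, ?_⟩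
    · rw [map_add, map_add, hc, hd, boundary_two_single, map_mul (proj r),
        map_mul (oneChain r), toAdd_mul]
      abel
    · rw [map_add, map_add, hc', hd', chainForm_single, heisLift_snd_mul, one_smul]

/-- The class of a relator is the value of the form on some `2`-cycle. -/
theorem exists_cycle (j : Fin m) : ∃ z : cycles₂ (triv (CommRelGroup r)),
    chainForm (basis r) z.1 = classModGammaThree (r j) := by
  obtain ⟨c, hc, hc'⟩ := exists_chain r (r j)
  have h1 : proj r (r j) = 1 :=
    (proj_eq_one_iff r _).2 (Subgroup.subset_normalClosure ⟨j, rfl⟩)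
  -- The letters of a commutator word cancel in an abelian group. The boundary of `c` is therefore
  -- minus the chain of the identity, which adding `(1, 1)` cancels.
  have h2 : oneChain r (r j) = 1 := Abelianization.commutator_subset_ker (oneChain r) (r j).2
  have hz : ((d₂₁ (triv (CommRelGroup r))).hom :
      (CommRelGroup r × CommRelGroup r →₀ ℤ) →ₗ[ℤ] (CommRelGroup r →₀ ℤ))
        (c + Finsupp.single (1, 1) 1) = 0 := by
    rw [map_add, hc, h1, h2, boundary_two_single, mul_one, toAdd_one]
    abel
  refine ⟨⟨c + Finsupp.single (1, 1) 1, hz⟩, ?_⟩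
  refine (map_add (chainForm (basis r)) c _).trans ?_
  rw [hc', chainForm_single, homOneMk_one, map_zero, smul_zero, add_zero,
    heisLift_snd_eq_classModGammaThree]

end CommRelGroup

/-! ### The isomorphism and its compatibility with the grading. -/

open CommRelGroup in
/-- The holonomy Lie algebra of a commutator-relators group is presented by the classes of the
relators. -/
def holonomyEquiv : HolonomyLieAlgebra (CommRelGroup r) ≃ₗ⁅ℤ⁆ RelatorLieAlgebra r :=
  LieQuot.congr (FreeLieOn.equivOfBasis (basis r))
    (by
      rintro _ ⟨c, rfl⟩
      obtain ⟨z, rfl⟩ := cycMk_surjective _ c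
      have h := chainForm_mem_relatorSpan r z
      rw [← equivOfBasis_bracket_holonomyMap] at h
      -- Membership in the linear span of the relator classes is stronger than membership in the
      -- ideal.
      exact LieSubmodule.submodule_span_le_lieSpan h)
    (by
      rintro _ ⟨j, rfl⟩
      obtain ⟨z, hz⟩ := exists_cycle r j
      refine LieSubmodule.subset_lieSpan ⟨cycMk _ z, ?_⟩
      change _ = (FreeLieOn.equivOfBasis (basis r)).symm (classModGammaThree (r j))
      rw [← hz, ← equivOfBasis_bracket_holonomyMap, LieEquiv.symm_apply_apply])

theorem holonomyEquiv_ι_x (i : Fin n) :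
    holonomyEquiv r (HolonomyLieAlgebra.ι (homOneMk (CommRelGroup.x r i))) =
      RelatorLieAlgebra.y r i := by
  have h : FreeLieOn.equivOfBasis (CommRelGroup.basis r)
      (FreeLieOn.ι ℤ _ (homOneMk (CommRelGroup.x r i))) = FreeLieAlgebra.of ℤ i := by
    rw [FreeLieOn.equivOfBasis_ι, ← CommRelGroup.basis_apply, Module.Basis.constr_basis]
  exact congrArg (LieQuot.mkHom (R := ℤ) (Set.range fun j => classModGammaThree (r j))) h

/-- The linear map from the first homology to the holonomy Lie algebra. -/
def HolonomyLieAlgebra.ιLinear (G : Type) [Group G] [Module.Free ℤ (HomOne G)]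
    [Module.Finite ℤ (HomOne G)] : HomOne G →ₗ[ℤ] HolonomyLieAlgebra G :=
  (LieQuot.mkHom (R := ℤ) (L := FreeLieOn ℤ (HomOne G)) (Set.range fun c : HomTwo G =>
    FreeLieOn.bracket ℤ (HomOne G) (holonomyMap G c))).toLinearMap ∘ₗ FreeLieOn.ι ℤ (HomOne G)

theorem map_holonomyEquiv_lengthPart (k : ℕ) :
    (lengthPart ℤ (Set.range (HolonomyLieAlgebra.ι (G := CommRelGroup r))) k).map
        (holonomyEquiv r).toLieHom.toLinearMap =
      lengthPart ℤ (Set.range (RelatorLieAlgebra.y r)) k := by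
  have hι : Submodule.span ℤ (Set.range (HolonomyLieAlgebra.ι (G := CommRelGroup r))) =
      Submodule.span ℤ (Set.range fun i =>
        HolonomyLieAlgebra.ι (homOneMk (CommRelGroup.x r i))) := by
    -- With linearity of the degree one map visible, its range is the image of the span of the
    -- basis.
    change Submodule.span ℤ (Set.range (HolonomyLieAlgebra.ιLinear (CommRelGroup r))) =
      Submodule.span ℤ (Set.range fun i =>
        HolonomyLieAlgebra.ιLinear (CommRelGroup r) (homOneMk (CommRelGroup.x r i)))
    have : (Set.range fun i =>
        HolonomyLieAlgebra.ιLinear (CommRelGroup r) (homOneMk (CommRelGroup.x r i))) =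
        HolonomyLieAlgebra.ιLinear (CommRelGroup r) '' Set.range (CommRelGroup.basis r) := by
      rw [← Set.range_comp]
      exact congrArg Set.range (funext fun i => by
        rw [Function.comp_apply, CommRelGroup.basis_apply])
    rw [this, ← Submodule.map_span, Module.Basis.span_eq, Submodule.map_top,
      ← LinearMap.coe_range, Submodule.span_eq]
  rw [lengthPart_eq_of_span_eq hι, map_lengthPart, ← Set.range_comp]
  congr 2
  exact funext fun i => holonomyEquiv_ι_x r i

end CommutatorRelatorsLemmas

end Holonomy

end

theorem proposition6p2 (n m : ℕ) (r : Fin m → commutator (FreeGroup (Fin n))) :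
    ∃ e : Holonomy.HolonomyLieAlgebra (Holonomy.CommRelGroup r) ≃ₗ⁅ℤ⁆ Holonomy.RelatorLieAlgebra r,
      (∀ i : Fin n, e (Holonomy.HolonomyLieAlgebra.ι
          (Holonomy.homOneMk (Holonomy.CommRelGroup.x r i))) = Holonomy.RelatorLieAlgebra.y r i) ∧
      ∀ (k : ℕ) (z : Holonomy.HolonomyLieAlgebra (Holonomy.CommRelGroup r)),
        z ∈ Holonomy.lengthPart ℤ
            (Set.range (Holonomy.HolonomyLieAlgebra.ι (G := Holonomy.CommRelGroup r))) k ↔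
          e z ∈ Holonomy.lengthPart ℤ (Set.range (Holonomy.RelatorLieAlgebra.y r)) k := by
  refine ⟨Holonomy.holonomyEquiv r, Holonomy.holonomyEquiv_ι_x r, fun k z => ?_⟩
  rw [← Holonomy.map_holonomyEquiv_lengthPart]
  exact ((Holonomy.holonomyEquiv r).injective.mem_set_image (s := SetLike.coe _)).symm
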